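/- **Theorem.** Logarithms are to base $2$, $|J|$ is the cardinality of $J$, and $B(x,r)$ is the (open) ball. A Borel measure $\mu$ on $\mathbb{R}^2$ is *$(t,C)$-Ahlfors–David regular* if $r^t/C\le \mu(B(x,r))\le C r^t$ for all $x\in\operatorname{spt}\mu$ and all $0<r\le \operatorname{diam}(\operatorname{spt}\mu)$. A set $X\subset\mathbb{R}^2$ is a *$(\delta,\alpha,C_1)$-set* if distinct points of $X$ are at distance at least $\delta$ and $|X\cap B(x,r)|\le C_1 (r/\delta)^{\alpha}$ for all $x\in\mathbb{R}^2$ and $\delta\le r\le 1$. For $e\in S^1$, $\pi_e\mu$ is the push-forward of $\mu$ under the orthogonal projection onto the line spanned by $e$, regarded as a measure on $\mathbb{R}$ via $x\mapsto\langle x,e\rangle$. For a Borel probability measure $\nu$ on $\mathbb{R}$ and $n\ge1$, $$H_n(\nu)=-\frac1n\sum_{Q\in\mathcal{D}_n}\nu(Q)\log\nu(Q),\qquad \mathcal{D}_n=\{[k2^{-n},(k+1)2^{-n}):k\in\mathbb{Z}\},\qquad 0\log 0:=0.$$ Let $\alpha,t\in(0,1]$, let $C,C_1,C_2>0$ and let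 $s<\min\{\alpha,t\}$. Then there are integers $m,n_0\ge 1$, depending only on $\alpha,t,C,C_1,C_2,s$, with the following property. Let $\mu$ be a $(t,C)$-Ahlfors–David regular Borel probability measure on $[0,1)^2$ whose support contains more than one point, let $\Omega\subset S^1$ be a $(2^{-m},\alpha,C_1)$-set with $|\Omega|\ge C_2 2^{m\alpha}$, and let $n\ge n_0$. Then $$\frac{1}{|\Omega|}\sum_{e\in\Omega}H_n(\pi_e\mu)\ \ge\ s .$$ -/

import Mathlib

open MeasureTheory

/-- The Euclidean plane. -/
abbrev Plane : Type := EuclideanSpace ℝ (Fin 2)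

/-- The half-open unit square `[0,1)²`. -/
def unitSquare : Set Plane := {x | ∀ i, x i ∈ Set.Ico (0 : ℝ) 1}

/-- `μ` is `(t, C)`-Ahlfors–David regular: `r ^ t / C ≤ μ (B(x, r)) ≤ C * r ^ t` for all `x` in the
(closed, topological) support of `μ` and all `0 < r ≤ diam (spt μ)`. The diameter is taken in
`[0, ∞]`, so that an unbounded support imposes the condition for every `r > 0`. -/
def IsADRegular (μ : Measure Plane) (t C : ℝ) : Prop :=
  ∀ x ∈ μ.support, ∀ r : ℝ, 0 < r → ENNReal.ofReal r ≤ Metric.ediam μ.support →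
    ENNReal.ofReal (r ^ t / C) ≤ μ (Metric.ball x r) ∧
      μ (Metric.ball x r) ≤ ENNReal.ofReal (C * r ^ t)

/-- `X` is a `(δ, s, C)`-set (in the sense of Katz and Tao): it is `δ`-separated and
`|X ∩ B(x, r)| ≤ C * (r / δ) ^ s` for all points `x` of the plane and all `δ ≤ r ≤ 1`. -/
def IsKatzTaoSet (X : Set Plane) (δ s C : ℝ) : Prop :=
  (X.Pairwise fun x y => δ ≤ dist x y) ∧
    ∀ x : Plane, ∀ r : ℝ, δ ≤ r → r ≤ 1 →
      (X ∩ Metric.ball x r).Finite ∧ ((X ∩ Metric.ball x r).ncard : ℝ) ≤ C * (r / δ) ^ s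

/-- The Shannon entropy, to base two, of `μ` with respect to a countable partition `P`:
`-∑ μ(P i) log₂ μ(P i)`. The convention `0 log 0 = 0` is automatic. -/
noncomputable def shannonEntropy {X ι : Type*} [MeasurableSpace X] (μ : Measure X)
    (P : ι → Set X) : ℝ :=
  -∑' i, μ.real (P i) * Real.logb 2 (μ.real (P i))

/-- The dyadic interval `[k 2⁻ⁿ, (k + 1) 2⁻ⁿ)` of the real line. -/
def dyadicInterval (n : ℕ) (k : ℤ) : Set ℝ :=
  Set.Ico ((k : ℝ) / 2 ^ n) (((k : ℝ) + 1) / 2 ^ n)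

/-- The normalized dyadic entropy `H_n(ν) = (1 / n) H(ν, 𝒟_n)`. If `ν` is a finite measure with
bounded support, as every projection of a measure on the unit square is, then only finitely many
terms of the sum that defines `H(ν, 𝒟_n)` are nonzero. -/
noncomputable def dyadicEntropy (n : ℕ) (ν : Measure ℝ) : ℝ :=
  1 / (n : ℝ) * shannonEntropy ν (dyadicInterval n)

/-- The push-forward `π_e μ` under the orthogonal projection to the line spanned by the unit vector
`e`, where the point `u • e` of the line is identified with the real number `u`. -/
noncomputable def projMeasure (e : Plane) (μ : Measure Plane) : Measure ℝ :=
  μ.map fun x => inner ℝ e x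

/-! Fix `e`, let S_k be the partition of the plane into strips on which ⟨e, x⟩ stays in one dyadic
interval of generation k, and Q_k the partition into dyadic squares. The point is that passing from
S_k to S_{k+m} gains, on average over `e ∈ Ω`, almost mβ bits, where β = min(α, t); the theorem
follows by iterating in steps of m.

Since S_{k+m} refines S_k, strong subadditivity (`entropyMap_submodular`) gives H(S_{k+m}) - H(S_k)
≥ H(S_{k+m} ∨ Q_k) - H(S_k ∨ Q_k), with no need for conditional measures. The subtracted entropy on
the right is at most kt + O(1) bits, because lower regularity bounds the number of charged cells
(`entropyMap_strip_square_le`).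

The other entropy is bounded below through collision probabilities, in the manner of Kaufman. Points
x, y at distance about 2^(-k-i) share a strip of S_{k+m} for a proportion at most about 2^((i-m)β)
of the directions, and such y have mass at most about 2^(-(k+i)t). As β ≤ t, each of the m + 1
scales i contributes O(2^(-mβ-kt)) (`sum_measureReal_strip_square_le`). Hence the average gain is at
least mβ - log(m+1) - O(1) bits, uniformly in k, and a large m makes the loss a small fraction of m.
-/

/-! ### Entropy of finite partitions -/

/-- The Shannon entropy, in nats, of the partition of a measure space into the fibres of `f`. -/
noncomputable def entropyMap {X ι : Type*} [MeasurableSpace X] (μ : Measure X) (f : X → ι) : ℝ :=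
  ∑' i, Real.negMulLog (μ.real (f ⁻¹' {i}))

theorem measureReal_fiber_eq_zero {X ι : Type*} [MeasurableSpace X] {μ : Measure X} {f : X → ι}
    {S : Finset ι} (hS : ∀ᵐ x ∂μ, f x ∈ S) {i : ι} (hi : i ∉ S) : μ.real (f ⁻¹' {i}) = 0 := by
  rw [measureReal_def, measure_mono_null (t := {x | ¬ f x ∈ S}) _ (ae_iff.1 hS)]
  · rfl
  · rintro x rfl
    exact hi

theorem entropyMap_eq_sum {X ι : Type*} [MeasurableSpace X] {μ : Measure X} {f : X → ι}
    {S : Finset ι} (hS : ∀ᵐ x ∂μ, f x ∈ S) :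
    entropyMap μ f = ∑ i ∈ S, Real.negMulLog (μ.real (f ⁻¹' {i})) :=
  tsum_eq_sum fun i hi => by rw [measureReal_fiber_eq_zero hS hi, Real.negMulLog_zero]

theorem entropyMap_nonneg {X ι : Type*} [MeasurableSpace X] {μ : Measure X}
    [IsProbabilityMeasure μ] (f : X → ι) : 0 ≤ entropyMap μ f :=
  tsum_nonneg fun _ => Real.negMulLog_nonneg measureReal_nonneg measureReal_le_one

theorem measureReal_comp_fiber {X ζ ι : Type*} [MeasurableSpace X] {μ : Measure X}
    [IsFiniteMeasure μ] [DecidableEq ι] {Z : X → ζ} (hZ : ∀ z, MeasurableSet (Z ⁻¹' {z}))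
    {U : Finset ζ} (hU : ∀ᵐ x ∂μ, Z x ∈ U) (G : ζ → ι) (i : ι) :
    μ.real ((fun x => G (Z x)) ⁻¹' {i}) = ∑ z ∈ U with G z = i, μ.real (Z ⁻¹' {z}) := by
  rw [sum_measureReal_preimage_singleton _ fun z _ => hZ z]
  refine measureReal_congr (Filter.eventuallyEq_set.2 ?_)
  filter_upwards [hU] with x hx
  simp [hx]

theorem sum_measureReal_fiber {X ζ : Type*} [MeasurableSpace X] {μ : Measure X}
    [IsProbabilityMeasure μ] {Z : X → ζ} (hZ : ∀ z, MeasurableSet (Z ⁻¹' {z}))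
    {U : Finset ζ} (hU : ∀ᵐ x ∂μ, Z x ∈ U) : ∑ z ∈ U, μ.real (Z ⁻¹' {z}) = 1 := by
  have := measureReal_comp_fiber hZ hU (fun _ => ()) ()
  simpa using this.symm

/-- Writing the entropy of a coarser partition as a sum over the cells of a finer one lets several
entropies be compared term by term over one index set. -/
theorem entropyMap_comp {X ζ ι : Type*} [MeasurableSpace X] {μ : Measure X}
    [IsFiniteMeasure μ] {Z : X → ζ} (hZ : ∀ z, MeasurableSet (Z ⁻¹' {z}))
    {U : Finset ζ} (hU : ∀ᵐ x ∂μ, Z x ∈ U) (G : ζ → ι) :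
    entropyMap μ (fun x => G (Z x)) =
      -∑ z ∈ U, μ.real (Z ⁻¹' {z}) * Real.log (μ.real ((fun x => G (Z x)) ⁻¹' {G z})) := by
  classical
  rw [entropyMap_eq_sum (S := U.image G)
    (hU.mono fun x hx => Finset.mem_image_of_mem G hx),
    ← Finset.sum_fiberwise_of_maps_to (g := G) (t := U.image G)
      fun z hz => Finset.mem_image_of_mem G hz, ← Finset.sum_neg_distrib]
  refine Finset.sum_congr rfl fun i _ => ?_
  rw [Real.negMulLog, neg_mul, neg_inj]
  nth_rewrite 1 [measureReal_comp_fiber hZ hU G i]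
  rw [Finset.sum_mul]
  refine Finset.sum_congr rfl fun z hz => ?_
  rw [(Finset.mem_filter.1 hz).2]

/-- If `0 ≤ a` and `w` is positive wherever `a` is, then `a log (w / a) ≤ w - a`. -/
theorem mul_log_sub_mul_log_le {a w : ℝ} (ha : 0 ≤ a) (hw : 0 ≤ w) (h : 0 < a → 0 < w) :
    a * Real.log w - a * Real.log a ≤ w - a := by
  rcases ha.eq_or_lt with rfl | ha
  · simpa using hw
  · have hw := h ha
    have := Real.log_le_sub_one_of_pos (div_pos hw ha)
    rw [Real.log_div hw.ne' ha.ne'] at this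
    have := mul_le_mul_of_nonneg_left this ha.le
    have e : a * (w / a - 1) = w - a := by field_simp
    linarith

/-- Strong subadditivity of Shannon entropy. -/
theorem entropyMap_submodular {X ι κ ζ : Type*} [MeasurableSpace X] {μ : Measure X}
    [IsProbabilityMeasure μ] {f : X → ι} {h : X → ζ} (g : ι → κ)
    (hf : ∀ i, MeasurableSet (f ⁻¹' {i})) (hh : ∀ i, MeasurableSet (h ⁻¹' {i}))
    {S : Finset ι} (hS : ∀ᵐ x ∂μ, f x ∈ S) {T : Finset ζ} (hT : ∀ᵐ x ∂μ, h x ∈ T) :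
    entropyMap μ (fun x => g (f x)) + entropyMap μ (fun x => (f x, h x)) ≤
      entropyMap μ f + entropyMap μ (fun x => (g (f x), h x)) := by
  classical
  set Z : X → ι × ζ := fun x => (f x, h x) with hZdef
  have hZ : ∀ z, MeasurableSet (Z ⁻¹' {z}) := fun z => by
    have : Z ⁻¹' {z} = f ⁻¹' {z.1} ∩ h ⁻¹' {z.2} := by
      ext x
      simp [hZdef, Prod.ext_iff]
    rw [this]
    exact (hf _).inter (hh _)
  have hU : ∀ᵐ x ∂μ, Z x ∈ S ×ˢ T := by
    filter_upwards [hS, hT] with x h1 h2 using Finset.mem_product.2 ⟨h1, h2⟩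
  have e1 := entropyMap_comp hZ hU (fun z => z.1)
  have e2 := entropyMap_comp hZ hU (fun z => g z.1)
  have e3 := entropyMap_comp hZ hU (fun z => z)
  have e4 := entropyMap_comp hZ hU (fun z => (g z.1, z.2))
  have mono : ∀ {A B : Set X}, A ⊆ B → μ.real A ≤ μ.real B := fun h => measureReal_mono h
  set p : ι → ℝ := fun i => μ.real (f ⁻¹' {i}) with hp
  set P : κ → ℝ := fun c => μ.real ((fun x => g (f x)) ⁻¹' {c}) with hP
  set b : κ × ζ → ℝ := fun c => μ.real ((fun x => (g (f x), h x)) ⁻¹' {c}) with hb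
  set a : ι × ζ → ℝ := fun z => μ.real (Z ⁻¹' {z}) with ha
  -- Gibbs' inequality: the joint law `a` of `(f, h)` is compared with the law having the same
  -- marginals on `f` and on `(g ∘ f, h)` but with `f` and `h` independent given `g ∘ f`. The latter
  -- has total mass at most one.
  have key : ∑ z ∈ S ×ˢ T, (a z * Real.log (p z.1 * b (g z.1, z.2) / P (g z.1)) -
      a z * Real.log (a z)) ≤ 0 := by
    have step : ∀ z ∈ S ×ˢ T, (a z * Real.log (p z.1 * b (g z.1, z.2) / P (g z.1)) -
        a z * Real.log (a z)) ≤ p z.1 * b (g z.1, z.2) / P (g z.1) - a z := by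
      intro z _
      refine mul_log_sub_mul_log_le measureReal_nonneg
        (div_nonneg (mul_nonneg measureReal_nonneg measureReal_nonneg) measureReal_nonneg) ?_
      intro hz
      refine div_pos (mul_pos (hz.trans_le (mono ?_)) (hz.trans_le (mono ?_)))
        (hz.trans_le (mono ?_)) <;> rintro x rfl <;> rfl
    refine (Finset.sum_le_sum step).trans ?_
    rw [Finset.sum_sub_distrib, sum_measureReal_fiber hZ hU, Finset.sum_product, sub_nonpos,
      ← sum_measureReal_fiber hf hS]
    refine Finset.sum_le_sum fun i _ => ?_
    have hsum : ∑ q ∈ T, b (g i, q) ≤ P (g i) := by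
      have := measureReal_comp_fiber (μ := μ.restrict ((fun x => g (f x)) ⁻¹' {g i})) hh
        (ae_restrict_of_ae hT) (fun _ => ()) ()
      simp only [hb, hP]
      have e : ∀ q, (fun x => (g (f x), h x)) ⁻¹' {(g i, q)} =
        h ⁻¹' {q} ∩ (fun x => g (f x)) ⁻¹' {g i} := fun q => by
          ext x
          simp [and_comm]
      simp only [measureReal_restrict_apply (hh _), Finset.filter_true] at this
      simp only [e]
      rw [← this]
      simp
    change ∑ q ∈ T, p i * b (g i, q) / P (g i) ≤ p i
    rw [← Finset.sum_div, ← Finset.mul_sum]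
    -- For a null cell, division by zero makes the comparison weight zero.
    rcases (measureReal_nonneg : 0 ≤ P (g i)).eq_or_lt with h0 | h0
    · rw [show P (g i) = 0 from h0.symm, div_zero]
      exact measureReal_nonneg
    · rw [div_le_iff₀ h0]
      exact mul_le_mul_of_nonneg_left hsum measureReal_nonneg
  have expand : ∀ z, a z * Real.log (p z.1 * b (g z.1, z.2) / P (g z.1)) - a z * Real.log (a z) =
      a z * Real.log (p z.1) + a z * Real.log (b (g z.1, z.2)) - a z * Real.log (P (g z.1)) -
      a z * Real.log (a z) := by
    intro z
    rcases (measureReal_nonneg : 0 ≤ a z).eq_or_lt with h0 | h0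
    · simp [show a z = 0 from h0.symm]
    · have h1 : 0 < p z.1 := h0.trans_le (mono (by rintro x rfl; rfl))
      have h2 : 0 < b (g z.1, z.2) := h0.trans_le (mono (by rintro x rfl; rfl))
      have h3 : 0 < P (g z.1) := h0.trans_le (mono (by rintro x rfl; rfl))
      rw [Real.log_div (by positivity) h3.ne', Real.log_mul h1.ne' h2.ne']
      ring
  simp only [expand, Finset.sum_sub_distrib, Finset.sum_add_distrib] at key
  change entropyMap μ f = -∑ z ∈ S ×ˢ T, a z * Real.log (p z.1) at e1
  change entropyMap μ (fun x => g (f x)) = -∑ z ∈ S ×ˢ T, a z * Real.log (P (g z.1)) at e2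
  change entropyMap μ Z = -∑ z ∈ S ×ˢ T, a z * Real.log (a z) at e3
  change entropyMap μ (fun x => (g (f x), h x)) =
    -∑ z ∈ S ×ˢ T, a z * Real.log (b (g z.1, z.2)) at e4
  rw [e1, e2, e3, e4]
  linarith

/-- Entropy is at most the logarithm of a bound for the number of cells of positive measure. -/
theorem entropyMap_le_log {X ι : Type*} [MeasurableSpace X] {μ : Measure X}
    [IsProbabilityMeasure μ] {f : X → ι} (hf : ∀ i, MeasurableSet (f ⁻¹' {i}))
    {S : Finset ι} (hS : ∀ᵐ x ∂μ, f x ∈ S) {M : ℝ} (hM : 0 < M)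
    (hcard : ((S.filter fun i => 0 < μ.real (f ⁻¹' {i})).card : ℝ) ≤ M) :
    entropyMap μ f ≤ Real.log M := by
  have h1 := sum_measureReal_fiber hf hS
  -- Gibbs' inequality against mass `M⁻¹` on each charged cell.
  have step : ∀ i ∈ S, μ.real (f ⁻¹' {i}) * Real.log (M⁻¹) -
      μ.real (f ⁻¹' {i}) * Real.log (μ.real (f ⁻¹' {i})) ≤
      (if 0 < μ.real (f ⁻¹' {i}) then M⁻¹ else 0) - μ.real (f ⁻¹' {i}) := by
    intro i _
    split_ifs with h
    · exact mul_log_sub_mul_log_le h.le (by positivity) fun _ => by positivity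
    · simp [le_antisymm (not_lt.1 h) measureReal_nonneg]
  have := Finset.sum_le_sum step
  rw [Finset.sum_sub_distrib, Finset.sum_sub_distrib, ← Finset.sum_mul, h1, ← Finset.sum_filter,
    Finset.sum_const, nsmul_eq_mul, Real.log_inv] at this
  have h2 := mul_le_mul_of_nonneg_right hcard (inv_pos.2 hM).le
  rw [mul_inv_cancel₀ hM.ne'] at h2
  rw [entropyMap_eq_sum hS]
  simp only [Real.negMulLog, neg_mul, Finset.sum_neg_distrib]
  linarith

/-- The linearized comparison of Shannon entropy with collision (Rényi) entropy. -/
theorem le_entropyMap_of_sq {X ι : Type*} [MeasurableSpace X] {μ : Measure X}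
    [IsProbabilityMeasure μ] {f : X → ι} (hf : ∀ i, MeasurableSet (f ⁻¹' {i}))
    {S : Finset ι} (hS : ∀ᵐ x ∂μ, f x ∈ S) {B : ℝ} (hB : 0 < B) :
    1 - Real.log B - (∑ i ∈ S, μ.real (f ⁻¹' {i}) ^ 2) / B ≤ entropyMap μ f := by
  have h1 := sum_measureReal_fiber hf hS
  have step : ∀ i ∈ S, μ.real (f ⁻¹' {i}) - Real.log B * μ.real (f ⁻¹' {i}) -
      μ.real (f ⁻¹' {i}) ^ 2 / B ≤ Real.negMulLog (μ.real (f ⁻¹' {i})) := by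
    intro i _
    rcases (measureReal_nonneg : 0 ≤ μ.real (f ⁻¹' {i})).eq_or_lt with h | h
    · simp [← h]
    · have := Real.log_le_sub_one_of_pos (div_pos h hB)
      rw [Real.log_div h.ne' hB.ne'] at this
      have := mul_le_mul_of_nonneg_left this h.le
      rw [Real.negMulLog]
      have e : μ.real (f ⁻¹' {i}) ^ 2 / B = μ.real (f ⁻¹' {i}) * (μ.real (f ⁻¹' {i}) / B) := by
        ring
      rw [e]
      linarith
  have := Finset.sum_le_sum step
  rw [Finset.sum_sub_distrib, Finset.sum_sub_distrib, ← Finset.mul_sum, h1,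
    ← Finset.sum_div] at this
  rw [entropyMap_eq_sum hS]
  linarith

/-! ### Cell counts and mass bounds for regular measures -/

/-- A fibre of positive measure contains a point of the support. -/
theorem exists_mem_support_of_pos {μ : Measure Plane} {A : Set Plane} (h : 0 < μ.real A) :
    ∃ x ∈ A, x ∈ μ.support := by
  by_contra! hne
  have : μ A = 0 := measure_mono_null (fun x hx => hne x hx) Measure.measure_compl_support
  simp [measureReal_def, this] at h

/-- If the ball of radius `r` about each support point has mass at least `c` and meets only cells
that are `D`-neighbours, there are at most `|D| / c` cells of positive measure. -/
theorem card_cells_mul_le {ι : Type*} [AddCommGroup ι] [DecidableEq ι] {μ : Measure Plane}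
    [IsProbabilityMeasure μ] {f : Plane → ι} (hf : ∀ i, MeasurableSet (f ⁻¹' {i}))
    {S : Finset ι} (D : Finset ι) {r c : ℝ}
    (hD : ∀ x y : Plane, y ∈ Metric.ball x r → f y - f x ∈ D)
    (hc : ∀ x ∈ μ.support, c ≤ μ.real (Metric.ball x r)) :
    ((S.filter fun i => 0 < μ.real (f ⁻¹' {i})).card : ℝ) * c ≤ D.card := by
  set S' := S.filter fun i => 0 < μ.real (f ⁻¹' {i})
  -- Double counting: the ball about a support point of cell `i` lies in the cells `i + d`. For
  -- fixed `d` these are distinct as `i` varies, so their masses add up to at most one.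
  have h1 : ∀ i ∈ S', c ≤ ∑ d ∈ D, μ.real (f ⁻¹' {i + d}) := by
    intro i hi
    obtain ⟨x, rfl, hx⟩ := exists_mem_support_of_pos (Finset.mem_filter.1 hi).2
    refine (hc x hx).trans ?_
    refine (measureReal_mono (s₂ := ⋃ d ∈ D, f ⁻¹' {f x + d}) ?_ (measure_ne_top _ _)).trans
      (measureReal_biUnion_finset_le _ _)
    intro y hy
    simp only [Set.mem_iUnion]
    exact ⟨_, hD x y hy, by simp⟩
  have h2 := Finset.sum_le_sum h1
  rw [Finset.sum_const, nsmul_eq_mul, Finset.sum_comm] at h2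
  refine h2.trans ?_
  have h3 : ∀ d ∈ D, ∑ i ∈ S', μ.real (f ⁻¹' {i + d}) ≤ 1 := by
    intro d _
    have := sum_measureReal_preimage_singleton (μ := μ) (S'.map (addRightEmbedding d)) (f := f)
      fun y _ => hf y
    rw [Finset.sum_map] at this
    simp only [addRightEmbedding_apply] at this
    rw [this]
    exact measureReal_le_one
  simpa using Finset.sum_le_sum h3

theorem dist_sq_plane (x y : Plane) : dist x y ^ 2 = (x 0 - y 0) ^ 2 + (x 1 - y 1) ^ 2 := by
  rw [EuclideanSpace.dist_eq, Real.sq_sqrt (by positivity), Fin.sum_univ_two, Real.dist_eq,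
    Real.dist_eq, sq_abs, sq_abs]

theorem abs_coord_sub_le_dist (x y : Plane) (i : Fin 2) : |x i - y i| ≤ dist x y := by
  refine abs_le_of_sq_le_sq ?_ dist_nonneg
  rw [dist_sq_plane]
  fin_cases i
  · exact le_add_of_nonneg_right (sq_nonneg _)
  · exact le_add_of_nonneg_left (sq_nonneg _)

/-- A regular probability measure obeys the upper bound, with a larger constant, at all scales, and
the lower bound at all scales up to `1`. -/
theorem IsADRegular.exists_bounds {t C : ℝ} (ht : 0 < t) (hC : 0 < C) {μ : Measure Plane}
    [IsProbabilityMeasure μ] (hμ : μ unitSquareᶜ = 0) (hnt : μ.support.Nontrivial)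
    (hreg : IsADRegular μ t C) :
    (∀ x ∈ μ.support, ∀ r : ℝ, 0 < r → μ.real (Metric.ball x r) ≤ 4 * C * r ^ t) ∧
    (∀ x ∈ μ.support, ∀ r : ℝ, 0 < r → r ≤ 1 →
      (max C 1)⁻¹ * r ^ t ≤ μ.real (Metric.ball x r)) := by
  have hbdd : Bornology.IsBounded μ.support := by
    have hcl : IsClosed {x : Plane | ∀ i, x i ∈ Set.Icc (0 : ℝ) 1} := by
      simp only [Set.ofPred_forall]
      exact isClosed_iInter fun i => isClosed_Icc.preimage (by fun_prop)
    refine Bornology.IsBounded.subset ?_ (Measure.support_subset_of_isClosed hcl ?_)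
    · refine (Metric.isBounded_closedBall (x := (0 : Plane)) (r := 2)).subset fun x hx => ?_
      rw [Metric.mem_closedBall]
      refine (pow_le_pow_iff_left₀ dist_nonneg (by norm_num) two_ne_zero).1 ?_
      rw [dist_sq_plane]
      have h0 := hx 0
      have h1 := hx 1
      simp only [Set.mem_Icc, PiLp.zero_apply, sub_zero] at *
      nlinarith
    · refine Filter.mem_of_superset (x := unitSquare) ?_ fun x hx i => Set.Ico_subset_Icc_self (hx i)
      exact hμ
  set D := Metric.diam μ.support
  have hDpos : 0 < D := Metric.diam_pos hnt hbdd
  have hediam : ∀ r : ℝ, r ≤ D → ENNReal.ofReal r ≤ Metric.ediam μ.support := fun r hr => by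
    rw [← ENNReal.ofReal_toReal hbdd.ediam_ne_top]
    exact ENNReal.ofReal_le_ofReal hr
  have upper : ∀ x ∈ μ.support, ∀ r : ℝ, 0 < r → r ≤ D →
      μ.real (Metric.ball x r) ≤ C * r ^ t := fun x hx r h0 hr =>
    ENNReal.toReal_le_of_le_ofReal (by positivity) (hreg x hx r h0 (hediam r hr)).2
  have lower : ∀ x ∈ μ.support, ∀ r : ℝ, 0 < r → r ≤ D →
      r ^ t / C ≤ μ.real (Metric.ball x r) := fun x hx r h0 hr =>
    (ENNReal.ofReal_le_iff_le_toReal (by finiteness)).1 (hreg x hx r h0 (hediam r hr)).1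
  have hdist : ∀ x ∈ μ.support, ∀ y ∈ μ.support, dist x y ≤ D := fun x hx y hy =>
    Metric.dist_le_diam_of_mem hbdd hx hy
  have hmid : ∀ i : Fin 2, ∃ c : ℝ, ∀ x ∈ μ.support, |x i - c| ≤ D / 2 := by
    intro i
    obtain ⟨x₀, hx₀⟩ := hnt.nonempty
    set A := (fun x : Plane => x i) '' μ.support
    have hA : A.Nonempty := ⟨_, x₀, hx₀, rfl⟩
    have hle : ∀ x ∈ μ.support, ∀ y ∈ μ.support, x i - y i ≤ D := fun x hx y hy =>
      (le_abs_self _).trans ((abs_coord_sub_le_dist x y i).trans (hdist x hx y hy))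
    have hAb : BddBelow A := ⟨x₀ i - D, by
      rintro _ ⟨y, hy, rfl⟩
      have := hle x₀ hx₀ y hy
      dsimp only
      linarith⟩
    refine ⟨sInf A + D / 2, fun x hx => ?_⟩
    have h1 : sInf A ≤ x i := csInf_le hAb ⟨x, hx, rfl⟩
    have h2 : x i - D ≤ sInf A := le_csInf hA (by
      rintro _ ⟨y, hy, rfl⟩
      have := hle x hx y hy
      dsimp only
      linarith)
    rw [abs_le]
    constructor <;> linarith
  choose c hc using hmid
  -- The open ball of radius `D` about a support point may miss part of the support. The midlines of
  -- the bounding box cut the support into four pieces of diameter at most `D / √2 < D`, and each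
  -- fits in such a ball; this is the source of the factor 4.
  have hone : 1 ≤ 4 * C * D ^ t := by
    let q : Plane → Bool × Bool := fun x => (decide (x 0 ≤ c 0), decide (x 1 ≤ c 1))
    have hq : ∀ b : Bool × Bool, μ.real (q ⁻¹' {b}) ≤ C * D ^ t := by
      intro b
      rcases (measureReal_nonneg : 0 ≤ μ.real (q ⁻¹' {b})).eq_or_lt with h | h
      · rw [← h]
        positivity
      obtain ⟨x, rfl, hx⟩ := exists_mem_support_of_pos h
      refine le_trans ?_ (upper x hx D hDpos le_rfl)
      rw [measureReal_def, measureReal_def]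
      refine ENNReal.toReal_mono (by finiteness) (measure_mono_ae ?_)
      filter_upwards [Measure.support_mem_ae (μ := μ)] with y hy hyq
      have hy' : q y = q x := hyq
      simp only [q, Prod.mk.injEq, decide_eq_decide] at hy'
      have hcoord : ∀ i : Fin 2, (y i ≤ c i ↔ x i ≤ c i) → (y i - x i) ^ 2 ≤ (D / 2) ^ 2 := by
        intro i hi
        have h1 := abs_le.1 (hc i x hx)
        have h2 := abs_le.1 (hc i y hy)
        refine sq_le_sq' ?_ ?_ <;>
        · by_cases h3 : x i ≤ c i
          · have := hi.2 h3
            linarith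
          · have : ¬ y i ≤ c i := fun h => h3 (hi.1 h)
            linarith
      refine lt_of_pow_lt_pow_left₀ 2 hDpos.le ?_
      rw [dist_sq_plane]
      have := hcoord 0 hy'.1
      have := hcoord 1 hy'.2
      nlinarith
    have : (1 : ℝ) ≤ ∑ b : Bool × Bool, μ.real (q ⁻¹' {b}) := by
      rw [← probReal_univ (μ := μ)]
      refine (measureReal_mono (s₂ := ⋃ b ∈ (Finset.univ : Finset (Bool × Bool)), q ⁻¹' {b})
        ?_ (measure_ne_top _ _)).trans (measureReal_biUnion_finset_le _ _)
      intro x _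
      simp
    refine this.trans ((Finset.sum_le_sum fun b _ => hq b).trans ?_)
    simp [mul_assoc]
  constructor
  · intro x hx r hr
    rcases le_total r D with h | h
    · refine (upper x hx r hr h).trans ?_
      have : 0 ≤ C * r ^ t := by positivity
      linarith
    · refine measureReal_le_one.trans (hone.trans ?_)
      gcongr
  · intro x hx r hr hr1
    have hmax : 0 < max C 1 := lt_max_of_lt_left hC
    rcases le_or_gt r D with h | h
    · refine le_trans ?_ (lower x hx r hr h)
      rw [div_eq_inv_mul]
      gcongr
      exact le_max_left _ _
    -- Beyond the diameter the ball carries full mass, and `max C 1 ≥ 1` makes the bound trivial for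
    -- `r ≤ 1`.
    · have : μ.real (Metric.ball x r) = 1 := by
        have h2 : μ (Metric.ball x r) = 1 := by
          rw [← prob_compl_eq_zero_iff Metric.isOpen_ball.measurableSet, ← mem_ae_iff]
          filter_upwards [Measure.support_mem_ae (μ := μ)] with y hy
          exact (hdist y hy x hx).trans_lt h
        simp [measureReal_def, h2]
      rw [this]
      exact mul_le_one₀ (inv_le_one_of_one_le₀ (le_max_right _ _)) (by positivity)
        (Real.rpow_le_one hr.le hr1 ht.le)

/-! ### Directions nearly orthogonal to a vector -/

theorem inner_plane (x y : Plane) : inner ℝ x y = x 0 * y 0 + x 1 * y 1 := by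
  simp [PiLp.inner_apply, Fin.sum_univ_two, mul_comm]

theorem norm_sq_plane (x : Plane) : ‖x‖ ^ 2 = x 0 ^ 2 + x 1 ^ 2 := by
  rw [EuclideanSpace.norm_sq_eq, Fin.sum_univ_two, Real.norm_eq_abs, Real.norm_eq_abs, sq_abs,
    sq_abs]

/-- Unit vectors nearly orthogonal to `z` are close to one of the two unit normals of `z`. -/
theorem exists_normal (z : Plane) (hz : z ≠ 0) : ∃ v : Plane, ∀ e : Plane, ‖e‖ = 1 → ∀ η : ℝ,
    |inner ℝ e z| < η * ‖z‖ → e ∈ Metric.ball v (2 * η) ∪ Metric.ball (-v) (2 * η) := by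
  have hn : 0 < ‖z‖ := norm_pos_iff.2 hz
  have hn2 := norm_sq_plane z
  -- The normal `v` is `z / ‖z‖` turned by a right angle, and `a`, `b` are the coordinates of `e`
  -- along `z / ‖z‖` and `v`. If `b ≥ 0`, then |e - v|² = 2 - 2b ≤ 2(1 - b²) = 2a² < 4η²; if `b ≤
  -- 0`, the same holds with `-v`.
  refine ⟨!₂[-(z 1) / ‖z‖, z 0 / ‖z‖], fun e he η h => ?_⟩
  have he2 := norm_sq_plane e
  rw [he, one_pow] at he2
  have hη : 0 < η := pos_of_mul_pos_left ((abs_nonneg _).trans_lt h) hn.le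
  rw [inner_plane] at h
  set a := (e 0 * z 0 + e 1 * z 1) / ‖z‖ with ha
  set b := (e 1 * z 0 - e 0 * z 1) / ‖z‖ with hb
  have hab : a ^ 2 + b ^ 2 = 1 := by
    rw [ha, hb]
    field_simp
    rw [hn2]
    linear_combination (-(z 0 ^ 2 + z 1 ^ 2)) * he2
  have haη : |a| < η := by
    rwa [ha, abs_div, abs_of_pos hn, div_lt_iff₀ hn]
  have haη2 : a ^ 2 < η ^ 2 := sq_lt_sq' (by linarith [(abs_lt.1 haη).1]) (abs_lt.1 haη).2
  have hv : (z 1 / ‖z‖) ^ 2 + (z 0 / ‖z‖) ^ 2 = 1 := by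
    field_simp
    linarith
  have hbe : b = e 1 * (z 0 / ‖z‖) - e 0 * (z 1 / ‖z‖) := by rw [hb]; ring
  rcases le_total 0 b with h0 | h0
  · left
    rw [Metric.mem_ball]
    refine lt_of_pow_lt_pow_left₀ 2 (by positivity) ?_
    rw [dist_sq_plane]
    simp only [Matrix.cons_val_zero, Matrix.cons_val_one]
    have : (e 0 - -(z 1) / ‖z‖) ^ 2 + (e 1 - z 0 / ‖z‖) ^ 2 = 2 - 2 * b := by
      rw [hbe, neg_div]
      linear_combination hv - he2
    rw [this]
    nlinarith
  · right
    rw [Metric.mem_ball]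
    refine lt_of_pow_lt_pow_left₀ 2 (by positivity) ?_
    rw [dist_sq_plane]
    simp only [PiLp.neg_apply, Matrix.cons_val_zero, Matrix.cons_val_one]
    have : (e 0 - -(-(z 1) / ‖z‖)) ^ 2 + (e 1 - -(z 0 / ‖z‖)) ^ 2 = 2 + 2 * b := by
      rw [hbe, neg_div]
      linear_combination hv - he2
    rw [this]
    nlinarith

/-- A large Katz–Tao set contains few directions nearly orthogonal to a given vector. -/
theorem card_nearly_orthogonal_le {Ω : Finset Plane} {m : ℕ} {α β C₁ C₂ : ℝ}
    (hC₁ : 0 < C₁) (hC₂ : 0 < C₂) (hβ : 0 ≤ β) (hβα : β ≤ α)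
    (hsph : (Ω : Set Plane) ⊆ Metric.sphere 0 1)
    (hΩ : IsKatzTaoSet (Ω : Set Plane) ((2 : ℝ) ^ (-(m : ℝ))) α C₁)
    (hcard : C₂ * (2 : ℝ) ^ ((m : ℝ) * α) ≤ (Ω.card : ℝ)) {z : Plane} (hz : z ≠ 0) {η : ℝ}
    (hη : (2 : ℝ) ^ (-(m : ℝ)) ≤ 2 * η) :
    ((Ω.filter fun e => |inner ℝ e z| < η * ‖z‖).card : ℝ) ≤
      max 1 (2 * C₁ / C₂) * (2 * η) ^ β * Ω.card := by
  classical
  have hδ : (0 : ℝ) < (2 : ℝ) ^ (-(m : ℝ)) := by positivity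
  have hη0 : 0 < 2 * η := hδ.trans_le hη
  rcases le_or_gt (2 * η) 1 with h1 | h1
  · obtain ⟨v, hv⟩ := exists_normal z hz
    have hball : ∀ w : Plane, ((Ω.filter fun e => e ∈ Metric.ball w (2 * η)).card : ℝ) ≤
        C₁ * (2 * η / (2 : ℝ) ^ (-(m : ℝ))) ^ α := fun w => by
      refine le_trans (le_of_eq ?_) (hΩ.2 w (2 * η) hη h1).2
      rw [← Set.ncard_coe_finset, Finset.coe_filter]
      rfl
    have hsub : (Ω.filter fun e => |inner ℝ e z| < η * ‖z‖) ⊆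
        (Ω.filter fun e => e ∈ Metric.ball v (2 * η)) ∪
        (Ω.filter fun e => e ∈ Metric.ball (-v) (2 * η)) := by
      intro e he
      rw [Finset.mem_filter] at he
      rw [← Finset.filter_or, Finset.mem_filter]
      exact ⟨he.1, hv e (by simpa using hsph he.1) η he.2⟩
    have h2 : ((Ω.filter fun e => |inner ℝ e z| < η * ‖z‖).card : ℝ) ≤
        2 * (C₁ * (2 * η / (2 : ℝ) ^ (-(m : ℝ))) ^ α) := by
      have h3 : ((Ω.filter fun e => |inner ℝ e z| < η * ‖z‖).card : ℝ) ≤ _ :=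
        Nat.cast_le.2 ((Finset.card_le_card hsub).trans (Finset.card_union_le _ _))
      push_cast at h3
      linarith [hball v, hball (-v)]
    refine h2.trans ?_
    have h4 : (2 * η / (2 : ℝ) ^ (-(m : ℝ))) ^ α = (2 * η) ^ α * (2 : ℝ) ^ ((m : ℝ) * α) := by
      rw [Real.div_rpow hη0.le hδ.le, Real.rpow_neg two_pos.le, Real.inv_rpow (by positivity),
        div_inv_eq_mul, ← Real.rpow_mul two_pos.le]
    rw [h4]
    calc 2 * (C₁ * ((2 * η) ^ α * (2 : ℝ) ^ ((m : ℝ) * α)))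
        = (2 * C₁ / C₂) * (2 * η) ^ α * (C₂ * (2 : ℝ) ^ ((m : ℝ) * α)) := by field_simp
      _ ≤ max 1 (2 * C₁ / C₂) * (2 * η) ^ β * Ω.card := by
        gcongr ?_ * ?_ * ?_
        · exact le_max_right _ _
        · exact Real.rpow_le_rpow_of_exponent_ge hη0 h1 hβα
  -- Radii above 1 are outside the Katz–Tao condition; the `max 1` in the constant lets the trivial
  -- count suffice.
  · have h2 : ((Ω.filter fun e => |inner ℝ e z| < η * ‖z‖).card : ℝ) ≤ Ω.card :=
      Nat.cast_le.2 (Finset.card_filter_le _ _)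
    refine h2.trans ?_
    have h3 : 1 ≤ (2 * η) ^ β := Real.one_le_rpow h1.le hβ
    have h4 : 1 ≤ max 1 (2 * C₁ / C₂) := le_max_left _ _
    exact le_mul_of_one_le_left (by positivity) (one_le_mul_of_one_le_of_one_le h4 h3)

/-- Dyadic form of the bound for the number of directions nearly orthogonal to `x - y`. -/
theorem card_nearly_orthogonal_le_sum {Ω : Finset Plane} {m : ℕ} {α β C₁ C₂ : ℝ}
    (hC₁ : 0 < C₁) (hC₂ : 0 < C₂) (hβ : 0 ≤ β) (hβα : β ≤ α) (hβ1 : β ≤ 1)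
    (hsph : (Ω : Set Plane) ⊆ Metric.sphere 0 1)
    (hΩ : IsKatzTaoSet (Ω : Set Plane) ((2 : ℝ) ^ (-(m : ℝ))) α C₁)
    (hcard : C₂ * (2 : ℝ) ^ ((m : ℝ) * α) ≤ (Ω.card : ℝ)) {r : ℝ} (hr : 0 < r) {x y : Plane}
    (hxy : dist y x < 2 * r) :
    ((Ω.filter fun e => |inner ℝ e (y - x)| < r / 2 ^ m).card : ℝ) ≤
      ∑ i ∈ Finset.range (m + 1), 2 * max 1 (2 * C₁ / C₂) * Ω.card * ((2 : ℝ) ^ i / 2 ^ m) ^ β *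
        (Metric.ball x (2 * r / 2 ^ i)).indicator 1 y := by
  have hA : 1 ≤ max 1 (2 * C₁ / C₂) := le_max_left _ _
  have hterm : ∀ i, 0 ≤ 2 * max 1 (2 * C₁ / C₂) * Ω.card * ((2 : ℝ) ^ i / 2 ^ m) ^ β *
      (Metric.ball x (2 * r / 2 ^ i)).indicator 1 y := fun i =>
    mul_nonneg (by positivity) (Set.indicator_nonneg (fun _ _ => zero_le_one) _)
  have hsingle : ∀ i ∈ Finset.range (m + 1), y ∈ Metric.ball x (2 * r / 2 ^ i) →
      2 * max 1 (2 * C₁ / C₂) * Ω.card * ((2 : ℝ) ^ i / 2 ^ m) ^ β ≤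
      ∑ i ∈ Finset.range (m + 1), 2 * max 1 (2 * C₁ / C₂) * Ω.card * ((2 : ℝ) ^ i / 2 ^ m) ^ β *
        (Metric.ball x (2 * r / 2 ^ i)).indicator 1 y := by
    intro i hi hy
    refine le_trans (le_of_eq ?_) (Finset.single_le_sum (fun j _ => hterm j) hi)
    rw [Set.indicator_of_mem hy, Pi.one_apply, mul_one]
  by_cases hlast : y ∈ Metric.ball x (2 * r / 2 ^ m)
  · refine le_trans ?_ (hsingle m (Finset.self_mem_range_succ m) hlast)
    rw [div_self (by positivity), Real.one_rpow, mul_one]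
    have h2 : ((Ω.filter fun e => |inner ℝ e (y - x)| < r / 2 ^ m).card : ℝ) ≤ Ω.card :=
      Nat.cast_le.2 (Finset.card_filter_le _ _)
    nlinarith [(Nat.cast_nonneg Ω.card : (0 : ℝ) ≤ Ω.card)]
  -- The first dyadic ball that misses `y` fixes the scale: r / 2^i ≤ ‖y - x‖ < 2r / 2^i. The term
  -- of that index alone dominates the count.
  · have hex : ∃ j, y ∉ Metric.ball x (2 * r / 2 ^ j) := ⟨m, hlast⟩
    classical
    set j := Nat.find hex with hj
    have hjm : j ≤ m := Nat.find_min' hex hlast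
    have hj0 : j ≠ 0 := by
      intro h0
      have := Nat.find_spec hex
      rw [← hj, h0] at this
      simp [Metric.mem_ball, hxy] at this
    obtain ⟨i, hi⟩ := Nat.exists_eq_succ_of_ne_zero hj0
    have hin : y ∈ Metric.ball x (2 * r / 2 ^ i) := by
      by_contra hcon
      have := Nat.find_min' hex hcon
      omega
    have hout : y ∉ Metric.ball x (2 * r / 2 ^ (i + 1)) := by
      have := Nat.find_spec hex
      rwa [← hj, hi] at this
    refine le_trans ?_ (hsingle i (Finset.mem_range.2 (by omega)) hin)
    have hlow : r / 2 ^ i ≤ ‖y - x‖ := by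
      rw [Metric.mem_ball, not_lt, dist_eq_norm] at hout
      refine le_trans (le_of_eq ?_) hout
      rw [pow_succ]
      field_simp
    have hup : ‖y - x‖ < 2 * r := by rwa [← dist_eq_norm]
    have hpos : 0 < ‖y - x‖ := lt_of_lt_of_le (by positivity) hlow
    have hη : r / 2 ^ m = r / 2 ^ m / ‖y - x‖ * ‖y - x‖ := by field_simp
    have hδ : (2 : ℝ) ^ (-(m : ℝ)) = 1 / 2 ^ m := by
      rw [Real.rpow_neg two_pos.le, Real.rpow_natCast, one_div]
    rw [hη]
    refine (card_nearly_orthogonal_le hC₁ hC₂ hβ hβα hsph hΩ hcard (norm_pos_iff.1 hpos) ?_).trans ?_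
    · rw [hδ, div_div, mul_div_assoc', div_le_div_iff₀ (by positivity) (by positivity)]
      have : (0 : ℝ) < 2 ^ m := by positivity
      nlinarith
    · have h5 : (2 * (r / 2 ^ m / ‖y - x‖)) ^ β ≤ 2 * ((2 : ℝ) ^ i / 2 ^ m) ^ β := by
        calc (2 * (r / 2 ^ m / ‖y - x‖)) ^ β ≤ (2 * ((2 : ℝ) ^ i / 2 ^ m)) ^ β := by
              refine Real.rpow_le_rpow (by positivity) ?_ hβ
              gcongr 2 * ?_
              rw [div_div, div_le_div_iff₀ (by positivity) (by positivity)]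
              rw [div_le_iff₀ (by positivity)] at hlow
              have : (0 : ℝ) < 2 ^ m := by positivity
              nlinarith
          _ = 2 ^ β * ((2 : ℝ) ^ i / 2 ^ m) ^ β := Real.mul_rpow two_pos.le (by positivity)
          _ ≤ 2 * ((2 : ℝ) ^ i / 2 ^ m) ^ β := by
              gcongr
              exact (Real.rpow_le_rpow_of_exponent_le one_le_two hβ1).trans_eq (Real.rpow_one 2)
      calc max 1 (2 * C₁ / C₂) * (2 * (r / 2 ^ m / ‖y - x‖)) ^ β * Ω.card
          ≤ max 1 (2 * C₁ / C₂) * (2 * ((2 : ℝ) ^ i / 2 ^ m) ^ β) * Ω.card :=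
            mul_le_mul_of_nonneg_right
              (mul_le_mul_of_nonneg_left h5 (zero_le_one.trans hA)) (Nat.cast_nonneg _)
        _ = _ := by ring

/-! ### Dyadic strips and squares -/

/-- The index of the dyadic interval of generation `k` that contains `⟨e, x⟩`. -/
noncomputable def stripIndex (k : ℕ) (e x : Plane) : ℤ := ⌊2 ^ k * (inner ℝ e x : ℝ)⌋

/-- The index of the dyadic square of generation `k` that contains `x`. -/
noncomputable def squareIndex (k : ℕ) (x : Plane) : ℤ × ℤ := (⌊2 ^ k * x 0⌋, ⌊2 ^ k * x 1⌋)

/-- Finitely many indices that account for the strips of generation `k` meeting `[0,1)²`. -/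
noncomputable def stripRange (k : ℕ) : Finset ℤ := Finset.Icc (-2 ^ (k + 1)) (2 ^ (k + 1))

theorem measurable_stripIndex (k : ℕ) (e : Plane) : Measurable (stripIndex k e) :=
  Int.measurable_floor.comp (by fun_prop)

theorem measurable_squareIndex (k : ℕ) : Measurable (squareIndex k) :=
  (Int.measurable_floor.comp (by fun_prop)).prodMk (Int.measurable_floor.comp (by fun_prop))

/-- This exhibits the coarse strip partition as a function of the fine one, the form that strong
subadditivity requires. -/
theorem stripIndex_eq_ediv (k m : ℕ) (e x : Plane) :
    stripIndex k e x = stripIndex (k + m) e x / 2 ^ m := by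
  have := Int.floor_div_natCast (2 ^ (k + m) * (inner ℝ e x : ℝ)) (2 ^ m)
  push_cast at this
  rw [stripIndex, stripIndex, ← this, pow_add, mul_right_comm, mul_div_cancel_right₀ _
    (by positivity)]

theorem floor_mem_stripRange (k : ℕ) {u : ℝ} (hu : |u| ≤ 2) : ⌊2 ^ k * u⌋ ∈ stripRange k := by
  have h := abs_le.1 hu
  have hk : (0 : ℝ) < 2 ^ k := by positivity
  rw [stripRange, Finset.mem_Icc]
  constructor
  · rw [Int.le_floor]
    push_cast
    rw [pow_succ]
    nlinarith
  · have : (⌊2 ^ k * u⌋ : ℝ) ≤ ((2 ^ (k + 1) : ℤ) : ℝ) := by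
      refine (Int.floor_le _).trans ?_
      push_cast
      rw [pow_succ]
      nlinarith
    exact_mod_cast this

theorem norm_le_two_of_mem_unitSquare {x : Plane} (hx : x ∈ unitSquare) : ‖x‖ ≤ 2 := by
  refine (pow_le_pow_iff_left₀ (norm_nonneg _) (by norm_num) two_ne_zero).1 ?_
  rw [norm_sq_plane]
  have h0 := hx 0
  have h1 := hx 1
  simp only [Set.mem_Ico] at h0 h1
  nlinarith

theorem stripIndex_mem_stripRange (k : ℕ) {e x : Plane} (he : ‖e‖ = 1) (hx : x ∈ unitSquare) :
    stripIndex k e x ∈ stripRange k := by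
  refine floor_mem_stripRange k ((abs_real_inner_le_norm e x).trans ?_)
  rw [he, one_mul]
  exact norm_le_two_of_mem_unitSquare hx

theorem squareIndex_mem (k : ℕ) {x : Plane} (hx : x ∈ unitSquare) :
    squareIndex k x ∈ stripRange k ×ˢ stripRange k := by
  rw [squareIndex, Finset.mem_product]
  constructor
  all_goals
    refine floor_mem_stripRange k (abs_le.2 ⟨?_, ?_⟩)
  · linarith [(hx 0).1]
  · linarith [(hx 0).2]
  · linarith [(hx 1).1]
  · linarith [(hx 1).2]

theorem floor_sub_floor_mem_Icc {a b : ℝ} (h : |a - b| < 1) : ⌊a⌋ - ⌊b⌋ ∈ Finset.Icc (-1) 1 := by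
  have h1 := abs_lt.1 h
  have ha := Int.floor_le a
  have ha' := Int.lt_floor_add_one a
  have hb := Int.floor_le b
  have hb' := Int.lt_floor_add_one b
  have c1 : (⌊a⌋ : ℝ) < ⌊b⌋ + 2 := by linarith
  have c2 : (⌊b⌋ : ℝ) < ⌊a⌋ + 2 := by linarith
  have c1' : ⌊a⌋ < ⌊b⌋ + 2 := by exact_mod_cast c1
  have c2' : ⌊b⌋ < ⌊a⌋ + 2 := by exact_mod_cast c2
  rw [Finset.mem_Icc]
  omega

/-- The joint partition into strips and squares of generation `k` has entropy about `t k log 2`. -/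
theorem entropyMap_strip_square_le {μ : Measure Plane} [IsProbabilityMeasure μ]
    (hμ : μ unitSquareᶜ = 0) {t c : ℝ} (hc : 0 < c)
    (hlow : ∀ x ∈ μ.support, ∀ r : ℝ, 0 < r → r ≤ 1 → c⁻¹ * r ^ t ≤ μ.real (Metric.ball x r))
    {e : Plane} (he : ‖e‖ = 1) (k : ℕ) :
    entropyMap μ (fun x => (stripIndex k e x, squareIndex k x)) ≤
      Real.log (27 * c) + k * t * Real.log 2 := by
  set r : ℝ := 1 / 2 ^ k with hr
  have hr0 : 0 < r := by positivity
  have hr1 : r ≤ 1 := by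
    rw [hr, div_le_one (by positivity)]
    exact one_le_pow₀ one_le_two
  have hae : ∀ᵐ x ∂μ, x ∈ unitSquare := hμ
  have hmeas : Measurable fun x => (stripIndex k e x, squareIndex k x) :=
    (measurable_stripIndex k e).prodMk (measurable_squareIndex k)
  have hrt : r ^ t = ((2 : ℝ) ^ (k * t))⁻¹ := by
    rw [hr, one_div, Real.inv_rpow (by positivity), Real.rpow_mul two_pos.le, Real.rpow_natCast]
  have hpos : (0 : ℝ) < 2 ^ (k * t) := by positivity
  have hM : Real.log (27 * c) + k * t * Real.log 2 = Real.log (27 * c * 2 ^ (k * t)) := by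
    rw [Real.log_mul (by positivity) hpos.ne', Real.log_rpow two_pos]
  rw [hM]
  refine entropyMap_le_log (fun i => hmeas (measurableSet_singleton i))
    (S := stripRange k ×ˢ (stripRange k ×ˢ stripRange k)) ?_ (by positivity) ?_
  · filter_upwards [hae] with x hx
    exact Finset.mk_mem_product (stripIndex_mem_stripRange k he hx) (squareIndex_mem k hx)
  -- Moving by less than 2^(-k) changes the strip index and both square indices by at most one each,
  -- hence 3³ = 27 neighbouring cells.
  · have h := card_cells_mul_le (μ := μ) (fun i => hmeas (measurableSet_singleton i))
      (S := stripRange k ×ˢ (stripRange k ×ˢ stripRange k))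
      (Finset.Icc (-1) 1 ×ˢ (Finset.Icc (-1) 1 ×ˢ Finset.Icc (-1) 1)) (r := r) (c := c⁻¹ * r ^ t)
      ?_ fun x hx => hlow x hx r hr0 hr1
    · have h27 : (Finset.Icc (-1 : ℤ) 1 ×ˢ (Finset.Icc (-1 : ℤ) 1 ×ˢ Finset.Icc (-1 : ℤ) 1)).card
          = 27 := by rfl
      rw [h27, hrt, ← mul_inv, ← div_eq_mul_inv, div_le_iff₀ (by positivity)] at h
      refine h.trans (le_of_eq ?_)
      push_cast
      ring
    · intro x y hy
      rw [Metric.mem_ball, hr, lt_div_iff₀ (by positivity)] at hy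
      have hscale : ∀ a b : ℝ, |a - b| ≤ dist y x → |2 ^ k * a - 2 ^ k * b| < 1 := by
        intro a b hab
        rw [← mul_sub, abs_mul, abs_of_pos (by positivity : (0 : ℝ) < 2 ^ k), mul_comm]
        exact (mul_le_mul_of_nonneg_right hab (by positivity)).trans_lt hy
      refine Finset.mk_mem_product (floor_sub_floor_mem_Icc (hscale _ _ ?_))
        (Finset.mk_mem_product (floor_sub_floor_mem_Icc (hscale _ _ (abs_coord_sub_le_dist y x 0)))
          (floor_sub_floor_mem_Icc (hscale _ _ (abs_coord_sub_le_dist y x 1))))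
      rw [← inner_sub_right, dist_eq_norm]
      simpa [he] using abs_real_inner_le_norm e (y - x)

/-! ### Entropy gain averaged over directions -/

/-- Averaged collision probabilities are bounded by averaged masses of the cells through a point. -/
theorem sum_sum_sq_le {X E ι : Type*} [MeasurableSpace X] {μ : Measure X} [IsProbabilityMeasure μ]
    (Ω : Finset E) (f : E → X → ι) (hf : ∀ e ∈ Ω, ∀ i, MeasurableSet (f e ⁻¹' {i}))
    (S : Finset ι) {B : ℝ} (hB : ∀ᵐ x ∂μ, ∑ e ∈ Ω, μ.real (f e ⁻¹' {f e x}) ≤ B) :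
    ∑ e ∈ Ω, ∑ i ∈ S, μ.real (f e ⁻¹' {i}) ^ 2 ≤ B := by
  have hint : ∀ e ∈ Ω, ∀ i, Integrable
      (fun x => μ.real (f e ⁻¹' {i}) * (f e ⁻¹' {i}).indicator 1 x) μ := fun e he i =>
    ((integrable_indicator_iff (hf e he i)).2
      (integrable_const (1 : ℝ)).integrableOn).const_mul _
  -- The squared mass of a cell is the integral over that cell of its mass.
  have h : ∑ e ∈ Ω, ∑ i ∈ S, μ.real (f e ⁻¹' {i}) ^ 2 =
      ∫ x, ∑ e ∈ Ω, ∑ i ∈ S, μ.real (f e ⁻¹' {i}) * (f e ⁻¹' {i}).indicator 1 x ∂μ := by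
    rw [integral_finsetSum _ fun e he => integrable_finsetSum _ fun i _ => hint e he i]
    refine Finset.sum_congr rfl fun e he => ?_
    rw [integral_finsetSum _ fun i _ => hint e he i]
    refine Finset.sum_congr rfl fun i _ => ?_
    rw [integral_const_mul, integral_indicator_one (hf e he i), sq]
  rw [h]
  refine (integral_mono_ae (g := fun _ => B) (integrable_finsetSum _ fun e he =>
    integrable_finsetSum _ fun i _ => hint e he i) (integrable_const _) ?_).trans_eq (by simp)
  filter_upwards [hB] with x hx
  refine (Finset.sum_le_sum fun e _ => ?_).trans hx
  classical
  by_cases hS : f e x ∈ S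
  · rw [Finset.sum_eq_single (f e x)]
    · simp
    · intro i _ hi
      rw [Set.indicator_of_notMem (fun h => hi h.symm), mul_zero]
    · exact fun h => absurd hS h
  · refine (Finset.sum_eq_zero fun i hi => ?_).trans_le measureReal_nonneg
    rw [Set.indicator_of_notMem (fun h => hS (by rwa [show f e x = i from h])), mul_zero]

/-- The collision bound is linear in the squared masses once `B` is fixed, so it can be summed over
`Ω`. Taking `B` to be the bound for the averaged cell mass makes the correction terms cancel. -/
theorem sum_le_entropyMap {X E ι : Type*} [MeasurableSpace X] {μ : Measure X}
    [IsProbabilityMeasure μ] (Ω : Finset E) (f : E → X → ι)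
    (hf : ∀ e ∈ Ω, ∀ i, MeasurableSet (f e ⁻¹' {i})) {S : Finset ι}
    (hS : ∀ e ∈ Ω, ∀ᵐ x ∂μ, f e x ∈ S) {B : ℝ} (hB : 0 < B)
    (hB' : ∀ᵐ x ∂μ, ∑ e ∈ Ω, μ.real (f e ⁻¹' {f e x}) ≤ Ω.card * B) :
    Ω.card * -Real.log B ≤ ∑ e ∈ Ω, entropyMap μ (f e) := by
  have h := Finset.sum_le_sum fun e he => le_entropyMap_of_sq (hf e he) (hS e he) hB
  refine le_trans ?_ h
  rw [Finset.sum_sub_distrib, Finset.sum_const, nsmul_eq_mul, ← Finset.sum_div]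
  have h2 := sum_sum_sq_le Ω f hf S hB'
  have h3 := div_le_div_of_nonneg_right h2 hB.le
  rw [mul_div_cancel_right₀ _ hB.ne'] at h3
  linarith

/-- The intersection of the square of generation `k` through `x` and the strip of generation
`k + m` through `x` that is orthogonal to `e` has, on average over `e`, small mass. -/
theorem sum_measureReal_strip_square_le {Ω : Finset Plane} {m : ℕ} {α β t C₁ C₂ U : ℝ}
    (hC₁ : 0 < C₁) (hC₂ : 0 < C₂) (hU : 0 < U) (hβ : 0 ≤ β) (hβα : β ≤ α) (hβt : β ≤ t)
    (ht1 : t ≤ 1) (hsph : (Ω : Set Plane) ⊆ Metric.sphere 0 1)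
    (hΩ : IsKatzTaoSet (Ω : Set Plane) ((2 : ℝ) ^ (-(m : ℝ))) α C₁)
    (hcard : C₂ * (2 : ℝ) ^ ((m : ℝ) * α) ≤ (Ω.card : ℝ)) {μ : Measure Plane}
    [IsProbabilityMeasure μ] {x : Plane}
    (hup : ∀ r : ℝ, 0 < r → μ.real (Metric.ball x r) ≤ U * r ^ t) (k : ℕ) :
    ∑ e ∈ Ω, μ.real ((fun y => (stripIndex (k + m) e y, squareIndex k y)) ⁻¹'
        {(stripIndex (k + m) e x, squareIndex k x)}) ≤
      Ω.card * (4 * max 1 (2 * C₁ / C₂) * U * (m + 1) * (2 : ℝ) ^ (-(m * β + k * t))) := by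
  set A := max 1 (2 * C₁ / C₂) with hA
  have hA1 : 1 ≤ A := le_max_left _ _
  have hA0 : 0 < A := by linarith
  set r : ℝ := 1 / 2 ^ k with hr
  have hr0 : 0 < r := by positivity
  set cell : Plane → Set Plane := fun e =>
    (fun y => (stripIndex (k + m) e y, squareIndex k y)) ⁻¹'
        {(stripIndex (k + m) e x, squareIndex k x)} with hcell
  have hmeas : ∀ e, MeasurableSet (cell e) := fun e =>
    ((measurable_stripIndex (k + m) e).prodMk (measurable_squareIndex k))
      (measurableSet_singleton _)
  have hscale : ∀ (l : ℕ) (a b : ℝ), ⌊2 ^ l * a⌋ = ⌊2 ^ l * b⌋ → |a - b| < 1 / 2 ^ l := by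
    intro l a b h
    have := Int.abs_sub_lt_one_of_floor_eq_floor h
    rwa [← mul_sub, abs_mul, abs_of_pos (by positivity), mul_comm,
      ← lt_div_iff₀ (by positivity)] at this
  have hstrip : ∀ e y, y ∈ cell e → |inner ℝ e (y - x)| < r / 2 ^ m := by
    intro e y hy
    have := hscale _ _ _ (Prod.ext_iff.1 (show (_, _) = (_, _) from hy)).1
    rwa [← inner_sub_right, pow_add, ← div_div] at this
  have hsquare : ∀ e y, y ∈ cell e → dist y x < 2 * r := by
    intro e y hy
    have h := (Prod.ext_iff.1 (show (_, _) = (_, _) from hy)).2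
    have h0 := abs_lt.1 (hscale _ _ _ (Prod.ext_iff.1 h).1)
    have h1 := abs_lt.1 (hscale _ _ _ (Prod.ext_iff.1 h).2)
    rw [← hr] at h0 h1
    refine lt_of_pow_lt_pow_left₀ 2 (by positivity) ?_
    rw [dist_sq_plane]
    have := sq_lt_sq' h0.1 h0.2
    have := sq_lt_sq' h1.1 h1.2
    nlinarith
  have hind : ∀ s : Set Plane, MeasurableSet s →
      Integrable (s.indicator (1 : Plane → ℝ)) μ := fun s hs =>
    (integrable_indicator_iff hs).2 (integrable_const (1 : ℝ)).integrableOn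
  have hball : ∀ i : ℕ, MeasurableSet (Metric.ball x (2 * r / 2 ^ i)) := fun i =>
    Metric.isOpen_ball.measurableSet
  -- With `y` fixed, the sum counts the directions whose cell through `x` contains `y`; all of them
  -- are nearly orthogonal to `y - x`. Integrating in `y` turns the indicators into ball masses.
  have hpt : ∀ y, ∑ e ∈ Ω, (cell e).indicator (1 : Plane → ℝ) y ≤
      ∑ i ∈ Finset.range (m + 1), 2 * A * Ω.card * ((2 : ℝ) ^ i / 2 ^ m) ^ β *
        (Metric.ball x (2 * r / 2 ^ i)).indicator 1 y := by
    intro y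
    by_cases hxy : dist y x < 2 * r
    · refine le_trans ?_ (card_nearly_orthogonal_le_sum hC₁ hC₂ hβ hβα (hβt.trans ht1) hsph hΩ
        hcard hr0 hxy)
      rw [Finset.card_filter]
      push_cast
      refine Finset.sum_le_sum fun e _ => ?_
      by_cases hy : y ∈ cell e
      · rw [Set.indicator_of_mem hy, if_pos (hstrip e y hy), Pi.one_apply]
      · rw [Set.indicator_of_notMem hy]
        split_ifs <;> norm_num
    · rw [Finset.sum_eq_zero fun e _ => Set.indicator_of_notMem (fun h => hxy (hsquare e y h)) _]
      exact Finset.sum_nonneg fun i _ =>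
        mul_nonneg (by positivity) (Set.indicator_nonneg (fun _ _ => zero_le_one) _)
  have hint := integral_mono (μ := μ)
    (integrable_finsetSum Ω fun e _ => hind _ (hmeas e))
    (integrable_finsetSum (Finset.range (m + 1)) fun i _ =>
      (hind _ (hball i)).const_mul (2 * A * Ω.card * ((2 : ℝ) ^ i / 2 ^ m) ^ β)) hpt
  rw [integral_finsetSum _ fun e _ => hind _ (hmeas e),
    integral_finsetSum _ fun i _ => (hind _ (hball i)).const_mul _] at hint
  simp only [integral_const_mul, integral_indicator_one (hmeas _),
    integral_indicator_one (hball _)] at hint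
  refine hint.trans ?_
  have hterm : ∀ i ∈ Finset.range (m + 1), 2 * A * Ω.card * ((2 : ℝ) ^ i / 2 ^ m) ^ β *
      μ.real (Metric.ball x (2 * r / 2 ^ i)) ≤
      Ω.card * (4 * A * U * (2 : ℝ) ^ (-(m * β + k * t))) := by
    intro i _
    -- In the exponent (i - m)β + (1 - k - i)t the part i(β - t) is nonpositive, and `t ≤ 1` leaves
    -- only a factor 2.
    have h1 : ((2 : ℝ) ^ i / 2 ^ m) ^ β * (2 * r / 2 ^ i) ^ t ≤
        2 * (2 : ℝ) ^ (-(m * β + k * t)) := by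
      have e1 : (2 : ℝ) ^ i / 2 ^ m = (2 : ℝ) ^ ((i : ℝ) - m) := by
        rw [Real.rpow_sub two_pos, Real.rpow_natCast, Real.rpow_natCast]
      have e2 : 2 * r / 2 ^ i = (2 : ℝ) ^ (1 - (k : ℝ) - i) := by
        rw [Real.rpow_sub two_pos, Real.rpow_sub two_pos, Real.rpow_natCast, Real.rpow_natCast,
          Real.rpow_one, hr, mul_one_div]
      have e3 : 2 * (2 : ℝ) ^ (-(m * β + k * t)) = (2 : ℝ) ^ (1 + -(m * β + k * t)) := by
        rw [Real.rpow_add two_pos, Real.rpow_one]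
      rw [e1, e2, e3, ← Real.rpow_mul two_pos.le, ← Real.rpow_mul two_pos.le,
        ← Real.rpow_add two_pos]
      refine Real.rpow_le_rpow_of_exponent_le one_le_two ?_
      have : (i : ℝ) * β ≤ i * t := mul_le_mul_of_nonneg_left hβt (Nat.cast_nonneg i)
      linarith
    have h2 := mul_le_mul_of_nonneg_left (hup (2 * r / 2 ^ i) (by positivity))
      (by positivity : 0 ≤ 2 * A * Ω.card * ((2 : ℝ) ^ i / 2 ^ m) ^ β)
    refine h2.trans ?_
    have h3 := mul_le_mul_of_nonneg_left h1 (by positivity : 0 ≤ 2 * A * Ω.card * U)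
    linarith
  refine (Finset.sum_le_sum hterm).trans (le_of_eq ?_)
  rw [Finset.sum_const, Finset.card_range, nsmul_eq_mul]
  push_cast
  ring

/-- The entropy gained, on average over `e`, in passing from generation `k` to `k + m`. -/
theorem sum_entropyMap_strip_add_le {Ω : Finset Plane} {m : ℕ} {α β t C₁ C₂ U c : ℝ}
    (hC₁ : 0 < C₁) (hC₂ : 0 < C₂) (hU : 0 < U) (hc : 0 < c) (hβ : 0 ≤ β) (hβα : β ≤ α)
    (hβt : β ≤ t) (ht1 : t ≤ 1) (hsph : (Ω : Set Plane) ⊆ Metric.sphere 0 1)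
    (hΩ : IsKatzTaoSet (Ω : Set Plane) ((2 : ℝ) ^ (-(m : ℝ))) α C₁)
    (hcard : C₂ * (2 : ℝ) ^ ((m : ℝ) * α) ≤ (Ω.card : ℝ)) {μ : Measure Plane}
    [IsProbabilityMeasure μ] (hμ : μ unitSquareᶜ = 0)
    (hup : ∀ x ∈ μ.support, ∀ r : ℝ, 0 < r → μ.real (Metric.ball x r) ≤ U * r ^ t)
    (hlow : ∀ x ∈ μ.support, ∀ r : ℝ, 0 < r → r ≤ 1 → c⁻¹ * r ^ t ≤ μ.real (Metric.ball x r))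
    (k : ℕ) :
    ∑ e ∈ Ω, entropyMap μ (stripIndex k e) + Ω.card * (m * β * Real.log 2 -
        Real.log (27 * c * (4 * max 1 (2 * C₁ / C₂) * U) * (m + 1))) ≤
      ∑ e ∈ Ω, entropyMap μ (stripIndex (k + m) e) := by
  have hA0 : 0 < max 1 (2 * C₁ / C₂) := lt_max_of_lt_left one_pos
  set A := max 1 (2 * C₁ / C₂)
  have hae : ∀ᵐ x ∂μ, x ∈ unitSquare := hμ
  have hnorm : ∀ e ∈ Ω, ‖e‖ = 1 := fun e he => by simpa using hsph he
  have hS : ∀ l : ℕ, ∀ e ∈ Ω, ∀ᵐ x ∂μ, stripIndex l e x ∈ stripRange l := fun l e he =>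
    hae.mono fun x hx => stripIndex_mem_stripRange l (hnorm e he) hx
  have hT : ∀ᵐ x ∂μ, squareIndex k x ∈ stripRange k ×ˢ stripRange k :=
    hae.mono fun x hx => squareIndex_mem k hx
  have hcoll := sum_le_entropyMap (μ := μ) Ω
    (fun e x => (stripIndex (k + m) e x, squareIndex k x))
    (fun e _ i => ((measurable_stripIndex (k + m) e).prodMk (measurable_squareIndex k))
      (measurableSet_singleton i))
    (S := stripRange (k + m) ×ˢ (stripRange k ×ˢ stripRange k))
    (fun e he => by
      filter_upwards [hS (k + m) e he, hT] with x h1 h2 using Finset.mk_mem_product h1 h2)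
    (B := 4 * A * U * (m + 1) * (2 : ℝ) ^ (-(m * β + k * t))) (by positivity)
    (by
      filter_upwards [Measure.support_mem_ae (μ := μ)] with x hx
      exact sum_measureReal_strip_square_le hC₁ hC₂ hU hβ hβα hβt ht1 hsph hΩ hcard (hup x hx) k)
  have hsub : ∀ e ∈ Ω, entropyMap μ (stripIndex k e) +
      entropyMap μ (fun x => (stripIndex (k + m) e x, squareIndex k x)) ≤
      entropyMap μ (stripIndex (k + m) e) + (Real.log (27 * c) + k * t * Real.log 2) := by
    intro e he
    have h := entropyMap_submodular (μ := μ) (f := stripIndex (k + m) e) (h := squareIndex k)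
      (fun i => i / 2 ^ m) (fun i => measurable_stripIndex _ e (measurableSet_singleton i))
      (fun i => measurable_squareIndex k (measurableSet_singleton i)) (hS (k + m) e he) hT
    simp only [← stripIndex_eq_ediv] at h
    have h2 := entropyMap_strip_square_le hμ hc hlow (hnorm e he) k
    exact h.trans (add_le_add_right h2 _)
  -- On summation, the `k * t * log 2` of the cell count cancels that of the collision bound, so the
  -- gain does not depend on `k`.
  have hsum := Finset.sum_le_sum hsub
  rw [Finset.sum_add_distrib, Finset.sum_add_distrib, Finset.sum_const, nsmul_eq_mul] at hsum
  have hlogB : Real.log (4 * A * U * (m + 1) * (2 : ℝ) ^ (-(m * β + k * t))) =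
      Real.log (4 * A * U * (m + 1)) - (m * β + k * t) * Real.log 2 := by
    rw [Real.log_mul (by positivity) (by positivity), Real.log_rpow two_pos]
    ring
  have hlogK : Real.log (27 * c * (4 * A * U) * (m + 1)) =
      Real.log (27 * c) + Real.log (4 * A * U * (m + 1)) := by
    rw [mul_assoc (27 * c), Real.log_mul (by positivity) (by positivity)]
  rw [hlogB] at hcoll
  rw [hlogK]
  linarith

/-! ### Iteration over scales and conclusion -/

theorem dyadicEntropy_projMeasure (n : ℕ) (e : Plane) (μ : Measure Plane) :
    dyadicEntropy n (projMeasure e μ) =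
      1 / (n : ℝ) * (entropyMap μ (stripIndex n e) / Real.log 2) := by
  rw [dyadicEntropy, shannonEntropy, entropyMap, ← tsum_neg, ← tsum_div_const]
  congr 1
  refine tsum_congr fun k => ?_
  have h : (projMeasure e μ).real (dyadicInterval n k) = μ.real (stripIndex n e ⁻¹' {k}) := by
    have hI : MeasurableSet (dyadicInterval n k) := measurableSet_Ico
    have hinner : Measurable fun x : Plane => inner ℝ e x := by fun_prop
    rw [projMeasure, measureReal_def, Measure.map_apply hinner hI, measureReal_def]
    congr 2
    ext x
    have hn : (0 : ℝ) < 2 ^ n := by positivity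
    rw [Set.mem_preimage, dyadicInterval, Set.mem_Ico, div_le_iff₀ hn, lt_div_iff₀ hn,
      Set.mem_preimage, Set.mem_singleton_iff, stripIndex, Int.floor_eq_iff, mul_comm]
  rw [h, Real.negMulLog, Real.logb]
  ring

/-- Logarithms grow more slowly than linear functions. -/
theorem exists_log_mul_succ_le {K γ : ℝ} (hK : 0 < K) (hγ : 0 < γ) :
    ∃ m : ℕ, 0 < m ∧ Real.log (K * (m + 1)) ≤ γ * m := by
  -- This yields log(K(m+1)) ≤ γ(m+1)/2, which is at most γm once m ≥ 1.
  have h := Real.isLittleO_log_id_atTop.bound (show 0 < γ / (2 * K) by positivity)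
  have ht : Filter.Tendsto (fun m : ℕ => K * ((m : ℝ) + 1)) Filter.atTop Filter.atTop :=
    (Filter.tendsto_atTop_add_const_right _ _ tendsto_natCast_atTop_atTop).const_mul_atTop hK
  obtain ⟨m, hm, hm1⟩ := ((ht.eventually h).and (Filter.eventually_ge_atTop 1)).exists
  refine ⟨m, hm1, ?_⟩
  have hm1' : (1 : ℝ) ≤ m := by exact_mod_cast hm1
  rw [Real.norm_eq_abs, Real.norm_eq_abs, id, abs_of_pos (by positivity : 0 < K * ((m : ℝ) + 1)),
    div_mul_eq_mul_div, mul_left_comm, mul_comm 2 K, mul_div_mul_left _ _ hK.ne'] at hm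
  have := (le_abs_self _).trans hm
  nlinarith

theorem theorem1p2 (α t C C₁ C₂ s : ℝ)
    (hα : α ∈ Set.Ioc (0 : ℝ) 1) (ht : t ∈ Set.Ioc (0 : ℝ) 1)
    (hC : 0 < C) (hC₁ : 0 < C₁) (hC₂ : 0 < C₂) (hs : s < min α t) :
    ∃ m n₀ : ℕ, 0 < m ∧ 0 < n₀ ∧
      ∀ (μ : Measure Plane) [IsProbabilityMeasure μ],
        μ unitSquareᶜ = 0 → μ.support.Nontrivial → IsADRegular μ t C →
        ∀ Ω : Finset Plane, (Ω : Set Plane) ⊆ Metric.sphere 0 1 →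
          IsKatzTaoSet (Ω : Set Plane) ((2 : ℝ) ^ (-(m : ℝ))) α C₁ →
          C₂ * (2 : ℝ) ^ ((m : ℝ) * α) ≤ (Ω.card : ℝ) →
          ∀ n : ℕ, n₀ ≤ n →
            s ≤ 1 / (Ω.card : ℝ) * ∑ e ∈ Ω, dyadicEntropy n (projMeasure e μ) := by
  set β := min α t
  have hβ : 0 < β := lt_min hα.1 ht.1
  -- Replacing `s` by `s'` keeps the target rate nonnegative. With `σ` midway, the gap `β - σ` pays
  -- for the logarithmic loss per step and `σ - s'` for the incomplete block of scales.
  set s' := max s 0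
  have hs' : s' < β := max_lt hs hβ
  have hs'0 : 0 ≤ s' := le_max_right _ _
  set σ := (β + s') / 2 with hσ
  have hlog2 : 0 < Real.log 2 := Real.log_pos one_lt_two
  have hA0 : 0 < max 1 (2 * C₁ / C₂) := lt_max_of_lt_left one_pos
  have hc : 0 < max C 1 := lt_max_of_lt_right one_pos
  obtain ⟨m, hm, hmlog⟩ := exists_log_mul_succ_le
    (K := 27 * max C 1 * (4 * max 1 (2 * C₁ / C₂) * (4 * C))) (γ := (β - σ) * Real.log 2)
    (by positivity) (mul_pos (by linarith) hlog2)
  -- The choice gives n(σ - s') ≥ mσ, so n s' ≤ (n - m)σ ≤ ⌊n/m⌋mσ; the `+ 1` also makes n positive.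
  refine ⟨m, ⌈m * σ / (σ - s')⌉₊ + 1, hm, Nat.succ_pos _, ?_⟩
  intro μ _ hμ hnt hreg Ω hsph hΩ hcard n hn
  obtain ⟨hup, hlow⟩ := hreg.exists_bounds ht.1 hC hμ hnt
  have hΩ0 : (0 : ℝ) < Ω.card := lt_of_lt_of_le (by positivity) hcard
  have hiter : ∀ k j : ℕ, Ω.card * (j * (m * σ * Real.log 2)) ≤
      ∑ e ∈ Ω, entropyMap μ (stripIndex (k + j * m) e) := by
    intro k j
    induction j with
    | zero => simpa using Finset.sum_nonneg fun e _ => entropyMap_nonneg (μ := μ) (stripIndex k e)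
    | succ j ih =>
      have h := sum_entropyMap_strip_add_le hC₁ hC₂ (by positivity : 0 < 4 * C) hc hβ.le
        (min_le_left _ _) (min_le_right _ _) ht.2 hsph hΩ hcard hμ hup hlow (k + j * m)
      have hgain := mul_le_mul_of_nonneg_left (show m * σ * Real.log 2 ≤ m * β * Real.log 2 -
        Real.log (27 * max C 1 * (4 * max 1 (2 * C₁ / C₂) * (4 * C)) * (m + 1)) by linarith)
        hΩ0.le
      rw [show k + (j + 1) * m = k + j * m + m by ring]
      push_cast
      linarith
  have hn0 : (m * σ / (σ - s') : ℝ) ≤ n :=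
    (Nat.le_ceil _).trans (by exact_mod_cast (Nat.le_succ _).trans hn)
  have hnpos : (0 : ℝ) < n := by exact_mod_cast (Nat.succ_pos _).trans_le hn
  rw [div_le_iff₀ (by linarith)] at hn0
  -- Starting from generation `n % m` makes the steps of length `m` end exactly at `n`; the initial
  -- entropy is only used to be nonnegative.
  have hmain := hiter (n % m) (n / m)
  rw [Nat.mod_add_div'] at hmain
  have hdiv : (n : ℝ) ≤ (n / m : ℕ) * m + m := by
    have h1 := Nat.mod_add_div' n m
    have h2 := Nat.mod_lt n hm
    exact_mod_cast (by omega : n ≤ n / m * m + m)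
  have hns : n * s' ≤ (n / m : ℕ) * (m * σ) := by
    have := mul_le_mul_of_nonneg_right hdiv (show 0 ≤ σ by linarith)
    linarith
  simp only [dyadicEntropy_projMeasure]
  rw [← Finset.mul_sum, ← Finset.sum_div]
  refine (le_max_left s 0).trans ?_
  have hfin : Ω.card * (n * s' * Real.log 2) ≤ ∑ e ∈ Ω, entropyMap μ (stripIndex n e) := by
    refine le_trans ?_ hmain
    refine mul_le_mul_of_nonneg_left ?_ hΩ0.le
    rw [← mul_assoc]
    exact mul_le_mul_of_nonneg_right hns hlog2.le
  calc s' = 1 / (Ω.card : ℝ) * (1 / n * (Ω.card * (n * s' * Real.log 2) / Real.log 2)) := by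
        field_simp
    _ ≤ _ := by gcongr
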